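/- Let $\mathbb F_q$ be a finite field and let $G$ be a finite acyclic ADT network over $\mathbb F_q$: a set of supernodes $V$, each with a finite set $I(V)$ of input ports and a finite set $O(V)$ of output ports, and a set $\mathcal E$ of edges $(e,e')$ from output ports to input ports, such that the directed graph induced on the supernodes has no directed cycle. Let $S$ be a supernode (the source) with processes $\mathcal X(S)=\{X(S,1),\dots,X(S,\mu)\}$. For a field $\mathbb K\supseteq\mathbb F_q$, a linear code over $\mathbb K$ consists of coefficients $\alpha_{(i,e)},\beta_{(e',e)},\varepsilon_{(e',(T,i))}\in \mathbb K$. For source symbols $X(S,i)\in \mathbb K$, it determines the symbols at the ports by $$Y(e)=\sum_{e'\in I(V)}\beta_{(e',e)}Y(e')\;\Bigl(+\sum_i\alpha_{(i,e)}X(S,i)\text{ if }V=S\Bigr)\quad(e\in O(V)),\qquad Y(e')=\sum_{(e,e')\in\mathcal E}Y(e)\quad(e'\text{ an input port}),$$ and the processes formed at a supernode $T$ by $Z(T,i)=\sum_{e'\in I(T)}\varepsilon_{(e',(T,i))}Y(e')$. A connection $(S,T,\mathcal X(S,T))$ with $\mathcal X(S,T)\subseteq\mathcal X(S)$ is established if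 $Z(T,i)=X(S,i)$ for every $X(S,i)\in\mathcal X(S,T)$ and all values of the source symbols. For a set $\mathcal C$ of connections, $(G,\mathcal C)$ is solvable over $\mathbb K$ if one linear code over $\mathbb K$ establishes all connections in $\mathcal C$, and solvable if it is solvable over some finite extension field $\mathbb K$ of $\mathbb F_q$. For a set $\mathcal T'$ of supernodes with $S\notin\mathcal T'$ let $\mathrm{mincut}(S,\mathcal T')=\min_\Omega \mathrm{rank}(G_\Omega)$, where $\Omega$ runs over the sets of supernodes with $S\in\Omega$ and $\Omega\cap\mathcal T'=\emptyset$, and $G_\Omega$ is the $0$-$1$ incidence matrix, over $\mathbb F_q$, of the edges from the output ports in $\Omega$ to the input ports outside $\Omega$. **Theorem (Two-level multicast).** Let $0\le K\le N$, let $T_1,\dots,T_N$ be supernodes different from $S$, let $\mathcal X(S,T_1),\dots,\mathcal X(S,T_K)\subseteq\mathcal X(S)$ be pairwise disjoint, and let $$\mathcal C=\{(S,T_i,\mathcal X(S,T_i)) : 1\le i\le K\}\cup\{(S,T_j,\mathcal X(S)) : K<j\le N\}.$$ Then $(G,\mathcal C)$ is solvable if and only if $$\mathrm{mincut}(S,\{T_i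 : i\in J\})\ \ge\ \sum_{i\in J}|\mathcal X(S,T_i)|\quad\text{for all } J\subseteq\{1,\dots,K\},\qquad\text{and}\qquad \mathrm{mincut}(S,T_j)\ge|\mathcal X(S)|\quad\text{for all } K<j\le N.$$ Moreover, if $q>N$, then $(G,\mathcal C)$ is solvable over $\mathbb F_q$ itself if and only if these conditions hold. -/

import Mathlib

universe u

/-- A (deterministic, ADT) wireless network: supernodes `V`, input ports `I`, output ports `O`;
every port belongs to a supernode, and edges run from output ports to input ports.
An output port with several edges is a broadcast, an input port with several edges is an
additive multiple access channel. -/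
structure ADTNetwork (V I O : Type*) where
  /-- the supernode owning an input port -/
  inNode : I → V
  /-- the supernode owning an output port -/
  outNode : O → V
  /-- `edge e e'`: there is an edge from the output port `e` to the input port `e'` -/
  edge : O → I → Prop

/-- A connection from the (fixed) source: the destination `dest` is to replicate
the source processes `X(S, i)` with `i ∈ demand`. -/
structure Connection (V : Type*) (μ : ℕ) where
  /-- the destination supernode -/
  dest : V
  /-- the indices of the requested source processes -/
  demand : Finset (Fin μ)

/-- A linear network code over `K` for a source with `μ` processes: the coefficients `α` at the
source, `β` at the supernodes, and `ε` at the destinations (`ε t i` are the coefficients used by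
the supernode `t` to form its replica of the `i`-th source process). Coefficients attached to
ports of different supernodes are never used. -/
structure LinearCode (V I O : Type*) (μ : ℕ) (K : Type*) where
  /-- source coefficients -/
  α : Fin μ → O → K
  /-- coefficients from an input port to an output port of the same supernode -/
  β : I → O → K
  /-- decoding coefficients -/
  ε : V → Fin μ → I → K

namespace ADTNetwork

variable {V I O : Type*}

/-- There is an edge from an output port of `v` to an input port of `w`. -/
def Adj (G : ADTNetwork V I O) (v w : V) : Prop :=
  ∃ e e', G.outNode e = v ∧ G.inNode e' = w ∧ G.edge e e'

/-- There is no directed cycle of supernodes. -/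
def Acyclic (G : ADTNetwork V I O) : Prop :=
  ∀ v, ¬ Relation.TransGen G.Adj v v

open Classical in
/-- The matrix `G_Ω` of a cut: the 0-1 incidence matrix between the output ports in `Ω` and the
input ports outside of `Ω`. -/
noncomputable def cutMatrix (G : ADTNetwork V I O) (F : Type*) [Field F] (Ω : Finset V) :
    Matrix {e : O // G.outNode e ∈ Ω} {e' : I // G.inNode e' ∉ Ω} F :=
  Matrix.of fun e e' => if G.edge e e' then 1 else 0

/-- `mincut(S, D)` for a source `S` and a set `D` of destinations: the minimum of `rank G_Ω` over
all sets `Ω` of supernodes that contain `S` and no element of `D`. (Such `Ω` exist when `S ∉ D`.) -/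
noncomputable def mincut [DecidableEq V] [Fintype I] (G : ADTNetwork V I O)
    (F : Type*) [Field F] (S : V) (D : Finset V) : ℕ :=
  sInf {r | ∃ Ω : Finset V, S ∈ Ω ∧ Disjoint D Ω ∧ r = (G.cutMatrix F Ω).rank}

open Classical in
/-- `yIn`, `yOut` are the symbols at the ports when the source symbols are `x` and the code `c` is
used: an output port carries a linear combination of the symbols at the input ports of its supernode
(plus a linear combination of the source symbols if that supernode is the source),
an input port receives the sum of the symbols of the output ports connected to it. -/
def IsTransmission [Fintype I] [Fintype O] (G : ADTNetwork V I O) {K : Type*} [Field K] {μ : ℕ}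
    (S : V) (c : LinearCode V I O μ K) (x : Fin μ → K) (yIn : I → K) (yOut : O → K) : Prop :=
  (∀ e, yOut e = (∑ e' with G.inNode e' = G.outNode e, c.β e' e * yIn e') +
      if G.outNode e = S then ∑ i, c.α i e * x i else 0) ∧
  (∀ e', yIn e' = ∑ e with G.edge e e', yOut e)

open Classical in
/-- The process `Z(t, i)` formed by the supernode `t` from the symbols at its input ports. -/
noncomputable def output [Fintype I] (G : ADTNetwork V I O) {K : Type*} [Field K] {μ : ℕ}
    (c : LinearCode V I O μ K) (yIn : I → K) (t : V) (i : Fin μ) : K :=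
  ∑ e' with G.inNode e' = t, c.ε t i e' * yIn e'

/-- The connections `C` from `S` can be established with coefficients in `K`: for some linear code
every destination replicates its requested processes, whatever the source symbols are.
(In an acyclic network the symbols at the ports are determined by the code and the source
symbols.) -/
def SolvableOver [Fintype I] [Fintype O] (G : ADTNetwork V I O) (K : Type*) [Field K] {μ : ℕ}
    (S : V) (C : Set (Connection V μ)) : Prop :=
  ∃ c : LinearCode V I O μ K, ∀ x : Fin μ → K, ∃ (yIn : I → K) (yOut : O → K),
    G.IsTransmission S c x yIn yOut ∧
      ∀ d ∈ C, ∀ i ∈ d.demand, G.output c yIn d.dest i = x i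

/-- `(G, C)` is solvable, for a network over the finite field `F`: the connections can be
established with symbols and coefficients in some finite extension field of `F`. -/
def Solvable [Fintype I] [Fintype O] (G : ADTNetwork V I O) (F : Type u) [Field F] {μ : ℕ}
    (S : V) (C : Set (Connection V μ)) : Prop :=
  ∃ (K : Type u) (_ : Field K) (_ : Finite K) (_ : Algebra F K), G.SolvableOver K S C

end ADTNetwork

/-- The connection set in which `T k` requests `X k` for every `k`, and every `T' l` requests all
source processes. -/
def twoLevelConnections {V : Type*} {μ K L : ℕ} (T : Fin K → V) (X : Fin K → Finset (Fin μ))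
    (T' : Fin L → V) : Set (Connection V μ) :=
  (Set.range fun k => ⟨T k, X k⟩) ∪ (Set.range fun l => ⟨T' l, Finset.univ⟩)

/-- The cut conditions of a two-level multicast. -/
def TwoLevelCutConditions {V I O : Type*} [DecidableEq V] [Fintype I] (G : ADTNetwork V I O)
    (F : Type*) [Field F] (S : V) {μ K L : ℕ} (T : Fin K → V) (X : Fin K → Finset (Fin μ))
    (T' : Fin L → V) : Prop :=
  (∀ J : Finset (Fin K), ∑ k ∈ J, (X k).card ≤ G.mincut F S (J.image T)) ∧
    ∀ l, μ ≤ G.mincut F S {T' l}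

/-! Necessity: if the signals crossing a cut `Ω` vanish, acyclicity forces every signal outside `Ω`
to vanish, hence also every symbol requested there. So the rank of the cut bounds the number of
symbols requested outside (`SolvableOver.card_le_cut`).

Sufficiency: attach a super-sink that receives one symbol from `T k` over a private edge for each
process requested by `T k`. The conditions for all `J` together say that every cut between `S` and
the super-sink has rank at least the total request. A code is then needed with full rank at the
super-sink and rank `μ` at every `T' l` (`exists_forall_le_codeRank`). An injective change of
variables at the source makes the super-sink receive exactly the requested symbols and keeps the `T'
l` decodable. What `T k` would send over a private edge is its decoded symbol.

The rank statement rests on one fact: the transfer map depends on each single coefficient through a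
rank-one perturbation. Over an infinite field some code maximizes the ranks at all sets of nodes at
once, and maximality forces the cut bound (`le_codeRank_of_forall_cut`). Along a line of rank-one
perturbations each receiver excludes at most one value, so more field elements than receivers
suffice to choose the coefficients one by one (`exists_common_point`). -/

/-! ### Linear algebra: rank-one perturbations, choice of a common point, rank under field
extension. -/

section LinearAlgebra

open Module

variable {K E W : Type*} [Field K] [AddCommGroup E] [Module K E] [AddCommGroup W] [Module K W]

/-- A rank-one perturbation which is independent of `f` on both sides increases the rank. -/
theorem finrank_range_add_smulRight [FiniteDimensional K E] (f : E →ₗ[K] W)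
    (q : E →ₗ[K] K) (h : W) (u : K) (hu : u ≠ 0) (x : E) (hfx : f x = 0) (hqx : q x ≠ 0)
    (hh : h ∉ LinearMap.range f) :
    finrank K (LinearMap.range f) + 1 ≤ finrank K (LinearMap.range (f + u • q.smulRight h)) := by
  have hmem : h ∈ LinearMap.range (f + u • q.smulRight h) := by
    -- Since `f` kills `x`, the perturbed map sends `x` to `(u * q x) • h`.
    refine ⟨(u * q x)⁻¹ • x, ?_⟩
    have : u * q x ≠ 0 := mul_ne_zero hu hqx
    simp only [map_smul, LinearMap.add_apply, LinearMap.smul_apply, LinearMap.smulRight_apply, hfx,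
      zero_add, smul_smul]
    rw [show (u * q x)⁻¹ * (u * q x) = 1 from inv_mul_cancel₀ this, one_smul]
  have hlt : LinearMap.range f < LinearMap.range (f + u • q.smulRight h) := by
    refine lt_of_le_of_ne ?_ fun heq => hh (heq ▸ hmem)
    rintro _ ⟨z, rfl⟩
    have : f z = (f + u • q.smulRight h) z - (u * q z) • h := by
      simp [smul_smul]
    rw [this]
    exact Submodule.sub_mem _ ⟨z, rfl⟩ (Submodule.smul_mem _ _ hmem)
  exact Submodule.finrank_lt_finrank_of_lt hlt

/-- On a line of rank-one perturbations that contains a map of rank at least `r`, at most one map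
has rank less than `r`. -/
theorem eq_of_finrank_range_add_smulRight_lt [FiniteDimensional K E] (f : E →ₗ[K] W)
    (q : E →ₗ[K] K) (h : W) (r : ℕ) (hr : r ≤ finrank K (LinearMap.range f)) (a b : K)
    (ha : finrank K (LinearMap.range (f + a • q.smulRight h)) < r)
    (hb : finrank K (LinearMap.range (f + b • q.smulRight h)) < r) : a = b := by
  by_contra hab
  set g := f + a • q.smulRight h with hg
  have hfg : ∀ z, f z = g z - (a * q z) • h := fun z => by simp [hg, smul_smul]
  by_cases hh : h ∈ LinearMap.range g
  · have : LinearMap.range f ≤ LinearMap.range g := by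
      rintro _ ⟨z, rfl⟩
      rw [hfg]
      exact Submodule.sub_mem _ ⟨z, rfl⟩ (Submodule.smul_mem _ _ hh)
    have := Submodule.finrank_mono this
    omega
  -- If such an `x` exists, moving from `a` to `b` raises the rank of `g` by one, while `f` exceeds
  -- `g` by at most one. Otherwise `q` vanishes on `ker g`, which then lies in `ker f`. Both
  -- contradict the rank drop.
  by_cases hx : ∃ x, g x = 0 ∧ q x ≠ 0
  · obtain ⟨x, hgx, hqx⟩ := hx
    have h1 := finrank_range_add_smulRight g q h (b - a) (sub_ne_zero.2 (Ne.symm hab)) x hgx hqx hh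
    have h2 : g + (b - a) • q.smulRight h = f + b • q.smulRight h := by
      rw [hg, sub_smul]; abel
    rw [h2] at h1
    have h3 : finrank K (LinearMap.range f) ≤ finrank K (LinearMap.range g) + 1 := by
      have hle : LinearMap.range f ≤ LinearMap.range g ⊔ K ∙ h := by
        rintro _ ⟨z, rfl⟩
        rw [hfg]
        exact Submodule.sub_mem _ (Submodule.mem_sup_left ⟨z, rfl⟩)
          (Submodule.smul_mem _ _ (Submodule.mem_sup_right (Submodule.mem_span_singleton_self h)))
      refine (Submodule.finrank_mono hle).trans ((Submodule.finrank_add_le_finrank_add_finrank _ _).trans ?_)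
      gcongr
      exact (finrank_span_le_card {h}).trans (by simp)
    omega
  · push Not at hx
    have hker : LinearMap.ker g ≤ LinearMap.ker f := by
      intro x hx'
      rw [LinearMap.mem_ker] at hx' ⊢
      rw [hfg, hx', hx x hx']
      simp
    have h1 := Submodule.finrank_mono hker
    have h2 := g.finrank_range_add_finrank_ker
    have h3 := f.finrank_range_add_finrank_ker
    omega

theorem finrank_range_eq_of_ker_eq {W' : Type*} [AddCommGroup W'] [Module K W']
    [FiniteDimensional K E] (f : E →ₗ[K] W) (g : E →ₗ[K] W')
    (h : LinearMap.ker f = LinearMap.ker g) :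
    finrank K (LinearMap.range f) = finrank K (LinearMap.range g) := by
  have h2 := g.finrank_range_add_finrank_ker
  have h3 := f.finrank_range_add_finrank_ker
  rw [h] at h3
  omega

/-- Two surjections from the same finite-dimensional space differ by an injective endomorphism. -/
theorem exists_injective_comp_eq [FiniteDimensional K E] (f g : E →ₗ[K] W)
    (hf : Function.Surjective f) (hg : Function.Surjective g) :
    ∃ A : E →ₗ[K] E, Function.Injective A ∧ f ∘ₗ A = g := by
  obtain ⟨R, hR⟩ := f.exists_rightInverse_of_surjective (LinearMap.range_eq_top.2 hf)
  obtain ⟨R', hR'⟩ := g.exists_rightInverse_of_surjective (LinearMap.range_eq_top.2 hg)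
  have hfR : ∀ w, f (R w) = w := fun w => LinearMap.congr_fun hR w
  have hgR : ∀ w, g (R' w) = w := fun w => LinearMap.congr_fun hR' w
  have hdim : finrank K (LinearMap.ker g) = finrank K (LinearMap.ker f) := by
    have h2 := g.finrank_range_add_finrank_ker
    have h3 := f.finrank_range_add_finrank_ker
    rw [LinearMap.range_eq_top.2 hf] at h3
    rw [LinearMap.range_eq_top.2 hg] at h2
    omega
  let e := LinearEquiv.ofFinrankEq _ _ hdim
  let p : E →ₗ[K] LinearMap.ker g :=
    (LinearMap.id - R' ∘ₗ g).codRestrict _ fun x => by simp [hgR]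
  -- Lift `g x` through `f`, and carry the `ker g` component of `x` isomorphically onto `ker f`: the
  -- first term gives `f ∘ A = g`, the second gives injectivity.
  let A : E →ₗ[K] E := R ∘ₗ g + (LinearMap.ker f).subtype ∘ₗ e.toLinearMap ∘ₗ p
  have hfA : f ∘ₗ A = g := by
    ext x
    have : f (e (p x) : E) = 0 := (e (p x)).2
    simp [A, hfR, this]
  refine ⟨A, ?_, hfA⟩
  rw [← LinearMap.ker_eq_bot, LinearMap.ker_eq_bot']
  intro x hx
  have hgx : g x = 0 := by rw [← hfA, LinearMap.comp_apply, hx, map_zero]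
  have h1 : A x = (e (p x) : E) := by simp [A, hgx]
  rw [hx] at h1
  have h2 : p x = 0 := e.injective (by rw [map_zero]; exact Subtype.ext h1.symm)
  have h3 : (p x : E) = x := by simp [p, hgx]
  rw [← h3, h2]; rfl

/-- If each of the conditions `P i` can be satisfied, and is lost for at most one value of every
variable, then they can be satisfied at once with values in any set of more elements than
there are conditions. -/
theorem exists_common_point {ι X K : Type*} [Fintype ι] [Finite X] (s : Finset K)
    (hs : Fintype.card ι < s.card) (P : ι → (X → K) → Prop)
    (hP : ∀ i p (p' : K → X → K) v, (∀ a, (∀ w, w ≠ v → p' a w = p w) ∧ p' a v = a) → P i p →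
      ∀ a b, ¬ P i (p' a) → ¬ P i (p' b) → a = b)
    (hne : ∀ i, ∃ p, P i p) : ∃ p : X → K, (∀ v, p v ∈ s) ∧ ∀ i, P i p := by
  classical
  have := Fintype.ofFinite X
  -- Fix the coordinates one at a time. Each condition keeps its own witness, and the witnesses need
  -- to agree only on the coordinates fixed so far.
  suffices H : ∀ A : Finset X, ∃ p₀ : X → K, (∀ v, p₀ v ∈ s) ∧
      ∀ i, ∃ p, P i p ∧ ∀ v ∈ A, p v = p₀ v by
    obtain ⟨p₀, h₀, h⟩ := H Finset.univ
    refine ⟨p₀, h₀, fun i => ?_⟩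
    obtain ⟨p, hp, hpp⟩ := h i
    rwa [← funext fun v => hpp v (Finset.mem_univ v)]
  intro A
  induction A using Finset.induction_on with
  | empty =>
    obtain ⟨a, ha⟩ := Finset.card_pos.1 (Nat.zero_lt_of_lt hs)
    exact ⟨fun _ => a, fun _ => ha, fun i => by simpa using hne i⟩
  | insert v A hv ih =>
    obtain ⟨p₀, h₀, h⟩ := ih
    choose p hp hpA using h
    obtain ⟨a, ha, hPa⟩ : ∃ a ∈ s, ∀ i, P i (Function.update (p i) v a) := by
      -- If every value in `s` spoiled some condition, then choosing one for each value would inject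
      -- `s` into `ι`.
      by_contra! hcon
      choose f hf using fun a : s => hcon a a.2
      have hinj : Function.Injective f := fun a b hab =>
        Subtype.ext (hP (f a) (p (f a)) (Function.update (p (f a)) v) v
          (fun c => ⟨fun w hw => by simp [hw], by simp⟩) (hp _) a b (hf a)
          (by rw [hab]; exact hf b))
      have := Fintype.card_le_of_injective f hinj
      simp at this
      omega
    refine ⟨Function.update p₀ v a, fun w => ?_, fun i => ⟨_, hPa i, fun w hw => ?_⟩⟩
    · by_cases hw : w = v
      · subst hw; simpa using ha
      · simpa [hw] using h₀ w
    · by_cases hw' : w = v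
      · subst hw'; simp
      · simpa [hw'] using hpA i w (Finset.mem_of_mem_insert_of_ne hw hw')

/-- A rank factorization through `Fin r`, together with one-sided inverses of its factors, certifies
the rank from both sides by matrix identities, and these survive the extension of scalars. -/
theorem Matrix.rank_map_algebraMap {m n F K : Type*} [Fintype m] [Fintype n] [Field F] [Field K]
    [Algebra F K] (A : Matrix m n F) : (A.map (algebraMap F K)).rank = A.rank := by
  classical
  let f := A.mulVecLin
  obtain ⟨r, hr⟩ : ∃ r, A.rank = r := ⟨_, rfl⟩
  let e : LinearMap.range f ≃ₗ[F] (Fin r → F) :=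
    LinearEquiv.ofFinrankEq _ _ (by rw [Module.finrank_fin_fun]; exact hr)
  let b : (Fin r → F) →ₗ[F] (m → F) := (LinearMap.range f).subtype ∘ₗ e.symm.toLinearMap
  let c : (n → F) →ₗ[F] (Fin r → F) := e.toLinearMap ∘ₗ f.rangeRestrict
  have hbc : b ∘ₗ c = f := by ext; simp [b, c]
  obtain ⟨b', hb'⟩ := b.exists_leftInverse_of_injective (by
    rw [LinearMap.ker_eq_bot]
    exact (Submodule.subtype_injective _).comp e.symm.injective)
  obtain ⟨c', hc'⟩ := c.exists_rightInverse_of_surjective (by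
    rw [LinearMap.range_eq_top]
    exact e.surjective.comp f.surjective_rangeRestrict)
  have hA : A = LinearMap.toMatrix' b * LinearMap.toMatrix' c := by
    rw [← LinearMap.toMatrix'_comp, hbc]
    exact (LinearMap.toMatrix'_toLin' A).symm
  have h1 : LinearMap.toMatrix' b' * A * LinearMap.toMatrix' c' = 1 := by
    rw [hA, ← Matrix.mul_assoc (LinearMap.toMatrix' b'), ← LinearMap.toMatrix'_comp, hb', Matrix.mul_assoc,
      ← LinearMap.toMatrix'_comp, hc']
    simp
  rw [hr]
  apply le_antisymm
  · conv_lhs => rw [hA, Matrix.map_mul]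
    exact (Matrix.rank_mul_le_left _ _).trans ((Matrix.rank_le_card_width _).trans (by simp))
  · have h2 := congrArg (fun M => (Matrix.map M (algebraMap F K)).rank) h1
    simp only [Matrix.map_mul] at h2
    rw [Matrix.map_one _ (map_zero _) (map_one _), Matrix.rank_one, Fintype.card_fin] at h2
    rw [← h2]
    exact (Matrix.rank_mul_le_left _ _).trans (Matrix.rank_mul_le_right _ _)

end LinearAlgebra

namespace ADTNetwork

/-! ### The linear system of an acyclic network and its dependence on single coefficients. -/

section Transfer

variable {V I O : Type*} [Fintype I] [Fintype O] (G : ADTNetwork V I O) {K : Type*} [Field K]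

open Classical in
/-- The symbols at the output ports as a function of those at the input ports. -/
noncomputable def outMap (β : I → O → K) : (I → K) →ₗ[K] (O → K) where
  toFun y e := ∑ e' with G.inNode e' = G.outNode e, β e' e * y e'
  map_add' y z := by ext e; simp [mul_add, Finset.sum_add_distrib]
  map_smul' a y := by ext e; simp [Finset.mul_sum, mul_left_comm]

open Classical in
/-- The symbols at the input ports as a function of those at the output ports. -/
noncomputable def edgeMap : (O → K) →ₗ[K] (I → K) where
  toFun z e' := ∑ e with G.edge e e', z e
  map_add' y z := by ext e; simp [Finset.sum_add_distrib]
  map_smul' a y := by ext e; simp [Finset.mul_sum]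

open Classical in
/-- The contribution of the output ports in `Ω` to the input ports outside of `Ω`. -/
noncomputable def cutMap (Ω : Set V) : (O → K) →ₗ[K] (I → K) where
  toFun z e' := ∑ e with G.edge e e' ∧ G.outNode e ∈ Ω ∧ G.inNode e' ∉ Ω, z e
  map_add' y z := by ext e; simp [Finset.sum_add_distrib]
  map_smul' a y := by ext e; simp [Finset.mul_sum]

open Classical in
/-- The symbols that the source injects at the output ports. -/
noncomputable def srcMap (S : V) {μ : ℕ} (α : Fin μ → O → K) : (Fin μ → K) →ₗ[K] (O → K) where
  toFun x e := if G.outNode e = S then ∑ i, α i e * x i else 0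
  map_add' y z := by ext e; by_cases h : G.outNode e = S <;> simp [h, mul_add, Finset.sum_add_distrib]
  map_smul' a y := by ext e; by_cases h : G.outNode e = S <;> simp [h, Finset.mul_sum, mul_left_comm]

open Classical in
/-- The restriction to the input ports of the nodes in `A`, extended by zero. -/
noncomputable def inProj (A : Set V) : (I → K) →ₗ[K] (I → K) where
  toFun y e' := if G.inNode e' ∈ A then y e' else 0
  map_add' y z := by ext e; by_cases h : G.inNode e ∈ A <;> simp [h]
  map_smul' a y := by ext e; by_cases h : G.inNode e ∈ A <;> simp [h]

variable {G}

theorem isTransmission_iff {S : V} {μ : ℕ} {c : LinearCode V I O μ K} {x : Fin μ → K} {yIn : I → K}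
    {yOut : O → K} : G.IsTransmission S c x yIn yOut ↔
      yOut = G.outMap c.β yIn + G.srcMap S c.α x ∧ yIn = G.edgeMap yOut := by
  simp only [IsTransmission, funext_iff]
  rfl

omit [Fintype I] [Fintype O] in
theorem wellFounded_adj [Finite V] (hG : G.Acyclic) : WellFounded G.Adj := by
  have : Std.Irrefl (Relation.TransGen G.Adj) := ⟨hG⟩
  exact (Finite.wellFounded_of_trans_of_irrefl (Relation.TransGen G.Adj)).mono
    fun _ _ h => Relation.TransGen.single h

/-- If nothing is injected outside of `Ω`, and the signals in `Ω` do not cross the cut,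
then all signals outside of `Ω` vanish. -/
theorem eq_zero_of_cutMap_eq_zero [Finite V] (hG : G.Acyclic) {β : I → O → K} {y : I → K}
    {w z : O → K} (hw : w = G.outMap β y + z) (hy : y = G.edgeMap w) (Ω : Set V)
    (hz : ∀ e, G.outNode e ∉ Ω → z e = 0) (hcut : G.cutMap Ω w = 0) :
    ∀ e', G.inNode e' ∉ Ω → y e' = 0 := by
  classical
  suffices H : ∀ v, v ∉ Ω → ∀ e', G.inNode e' = v → y e' = 0 from
    fun e' he' => H _ he' e' rfl
  intro v
  -- A node outside `Ω` hears a crossing part, which is zero by `hcut`, and nodes outside `Ω`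
  -- upstream of it, which are silent by induction.
  induction v using (wellFounded_adj hG).induction with
  | h v ih =>
    rintro hv a rfl
    have h1 : ∑ e with G.edge e a ∧ G.outNode e ∈ Ω ∧ G.inNode a ∉ Ω, w e = 0 := by
      convert congrFun hcut a using 1
      simp only [cutMap, LinearMap.coe_mk, AddHom.coe_mk]
      congr!
    rw [hy]
    rw [← h1]
    symm
    simp only [edgeMap, LinearMap.coe_mk, AddHom.coe_mk]
    refine Finset.sum_subset (fun e he => ?_) fun e he he' => ?_
    · simp only [Finset.mem_filter, Finset.mem_univ, true_and] at he ⊢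
      exact he.1
    · simp only [Finset.mem_filter, Finset.mem_univ, true_and] at he he'
      have ho : G.outNode e ∉ Ω := fun h => he' ⟨he, h, hv⟩
      rw [hw, Pi.add_apply, hz e ho, add_zero]
      refine Finset.sum_eq_zero fun b hb => ?_
      simp only [Finset.mem_filter, Finset.mem_univ, true_and] at hb
      rw [ih (G.outNode e) ⟨e, a, rfl, rfl, he⟩ ho b hb, mul_zero]

/-- Apply the preceding vanishing result to the empty cut without injection. Injectivity makes the
system invertible, so the code determines the port symbols. -/
theorem sysMap_injective [Finite V] (hG : G.Acyclic) (β : I → O → K) :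
    Function.Injective (LinearMap.id - G.edgeMap ∘ₗ G.outMap β : (I → K) →ₗ[K] (I → K)) := by
  rw [← LinearMap.ker_eq_bot, LinearMap.ker_eq_bot']
  intro y hy
  ext a
  refine eq_zero_of_cutMap_eq_zero hG (β := β) (y := y) (w := G.outMap β y) (z := 0) (by simp)
    (sub_eq_zero.1 hy) ∅ (by simp) ?_ a (by simp)
  ext a
  simp [cutMap]

/-- The symbols at the input ports when `z` is injected at the output ports. -/
noncomputable def response [Finite V] (hG : G.Acyclic) (β : I → O → K) : (O → K) →ₗ[K] (I → K) :=
  (LinearEquiv.ofInjectiveEndo _ (sysMap_injective hG β)).symm.toLinearMap ∘ₗ G.edgeMap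

theorem eq_response_iff [Finite V] (hG : G.Acyclic) {β : I → O → K} {z : O → K} {y : I → K} :
    y = response hG β z ↔ y = G.edgeMap (G.outMap β y + z) := by
  rw [response, LinearMap.comp_apply, LinearEquiv.coe_coe, LinearEquiv.eq_symm_apply,
    LinearEquiv.coe_ofInjectiveEndo, LinearMap.sub_apply, sub_eq_iff_eq_add, map_add, add_comm]
  rfl

theorem response_eq [Finite V] (hG : G.Acyclic) (β : I → O → K) (z : O → K) :
    response hG β z = G.edgeMap (G.outMap β (response hG β z) + z) :=
  (eq_response_iff hG).1 rfl

/-- The symbols at the input ports as a function of the source symbols. -/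
noncomputable def transfer [Finite V] (hG : G.Acyclic) (S : V) {μ : ℕ} (α : Fin μ → O → K)
    (β : I → O → K) : (Fin μ → K) →ₗ[K] (I → K) :=
  response hG β ∘ₗ G.srcMap S α

theorem IsTransmission.eq_transfer [Finite V] (hG : G.Acyclic) {S : V} {μ : ℕ}
    {c : LinearCode V I O μ K} {x : Fin μ → K} {yIn : I → K} {yOut : O → K}
    (h : G.IsTransmission S c x yIn yOut) : yIn = transfer hG S c.α c.β x := by
  obtain ⟨h1, h2⟩ := isTransmission_iff.1 h
  exact (eq_response_iff hG).2 (by rwa [h1] at h2)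

theorem isTransmission_transfer [Finite V] (hG : G.Acyclic) (S : V) {μ : ℕ}
    (c : LinearCode V I O μ K) (x : Fin μ → K) :
    G.IsTransmission S c x (transfer hG S c.α c.β x)
      (G.outMap c.β (transfer hG S c.α c.β x) + G.srcMap S c.α x) :=
  isTransmission_iff.2 ⟨rfl, response_eq hG _ _⟩

/-- An injection at a node does not come back to that node. -/
theorem response_single_eq_zero [Finite V] [DecidableEq O] (hG : G.Acyclic) (β : I → O → K) (e : O)
    (a : K) (b : I) (hb : G.inNode b = G.outNode e) : response hG β (Pi.single e a) b = 0 := by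
  classical
  set y := response hG β (Pi.single e a) with hy
  set w := G.outMap β y + Pi.single e a with hw
  have hyw : y = G.edgeMap w := response_eq hG _ _
  -- The complement of `Ω` consists of the nodes strictly upstream of `e`. No edge enters it from
  -- `Ω`, and acyclicity puts the node of `e` in `Ω`, so everything upstream is silent.
  let Ω : Set V := {v | ¬ Relation.TransGen G.Adj v (G.outNode e)}
  have h0 : ∀ e', G.inNode e' ∉ Ω → y e' = 0 := by
    refine eq_zero_of_cutMap_eq_zero hG hw hyw Ω (fun o ho => ?_) ?_
    · simp only [Ω, Set.mem_ofPred_eq, not_not] at ho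
      rw [Pi.single_eq_of_ne]
      rintro rfl
      exact hG _ ho
    · ext b'
      refine Finset.sum_eq_zero fun o ho => ?_
      simp only [Finset.mem_filter, Finset.mem_univ, true_and, Ω, Set.mem_ofPred_eq, not_not] at ho
      exact absurd (Relation.TransGen.head ⟨o, b', rfl, rfl, ho.1⟩ ho.2.2) ho.2.1
  rw [hyw]
  refine Finset.sum_eq_zero fun o ho => ?_
  simp only [Finset.mem_filter, Finset.mem_univ, true_and] at ho
  have hadj : G.Adj (G.outNode o) (G.outNode e) := ⟨o, b, rfl, hb, ho⟩
  have hoe : o ≠ e := by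
    rintro rfl
    exact hG _ (.single hadj)
  rw [hw, Pi.add_apply, Pi.single_eq_of_ne hoe, add_zero]
  refine Finset.sum_eq_zero fun b' hb' => ?_
  simp only [Finset.mem_filter, Finset.mem_univ, true_and] at hb'
  rw [h0 b' (by simp only [Ω, Set.mem_ofPred_eq, not_not, hb']; exact .single hadj), mul_zero]

/-- The effect of changing one source coefficient. -/
theorem transfer_add_single_source [Finite V] [DecidableEq O] (hG : G.Acyclic) {S : V} {μ : ℕ}
    (α α' : Fin μ → O → K) (β : I → O → K) (i : Fin μ) (e : O) (he : G.outNode e = S) (t : K)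
    (hα : ∀ j o, α' j o = α j o + if j = i ∧ o = e then t else 0) :
    transfer hG S α' β = transfer hG S α β +
      t • (LinearMap.proj i : (Fin μ → K) →ₗ[K] K).smulRight (response hG β (Pi.single e 1)) := by
  have h : ∀ x, G.srcMap S α' x = G.srcMap S α x + (t * x i) • Pi.single e 1 := by
    intro x
    ext o
    simp only [srcMap, LinearMap.coe_mk, AddHom.coe_mk, Pi.add_apply, Pi.smul_apply, hα, add_mul,
      Finset.sum_add_distrib, smul_eq_mul]
    by_cases ho : o = e
    · subst ho
      simp [he]
    · simp [ho]
  refine LinearMap.ext fun x => ?_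
  simp only [transfer, LinearMap.comp_apply, h, map_add, map_smul, LinearMap.add_apply,
    LinearMap.smul_apply, LinearMap.smulRight_apply, LinearMap.proj_apply, smul_smul]

/-- The effect of changing one coefficient inside of the network. -/
theorem transfer_add_single [Finite V] [DecidableEq I] [DecidableEq O] (hG : G.Acyclic) {S : V} {μ : ℕ}
    (α : Fin μ → O → K) (β β' : I → O → K) (b : I) (e : O) (hb : G.inNode b = G.outNode e) (t : K)
    (hβ : ∀ a o, β' a o = β a o + if a = b ∧ o = e then t else 0) :
    transfer hG S α β' = transfer hG S α β +
      t • ((LinearMap.proj b : (I → K) →ₗ[K] K) ∘ₗ transfer hG S α β).smulRight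
        (response hG β (Pi.single e 1)) := by
  have h : ∀ y, G.outMap β' y = G.outMap β y + (t * y b) • Pi.single e 1 := by
    intro y
    ext o
    simp only [outMap, LinearMap.coe_mk, AddHom.coe_mk, Pi.add_apply, Pi.smul_apply, hβ, add_mul,
      Finset.sum_add_distrib, smul_eq_mul]
    by_cases ho : o = e
    · subst ho
      simp [hb]
    · simp [ho]
  refine LinearMap.ext fun x => ?_
  set y := transfer hG S α β x with hy
  set y' := transfer hG S α β' x with hy'
  -- Changing the coefficient by `t` amounts to injecting `t * y' b` at `e` in the old network.
  have h1 : y' = y + (t * y' b) • response hG β (Pi.single e 1) := by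
    rw [hy, transfer, LinearMap.comp_apply, ← map_smul, ← map_add, eq_response_iff]
    conv_lhs => rw [hy', transfer, LinearMap.comp_apply, response_eq]
    rw [h]
    change G.edgeMap (_ + (t * y' b) • _ + _) = _
    rw [add_assoc, add_comm ((t * y' b) • _)]
    rfl
  -- The injection at `e` does not return to its own node, where `b` lies. This makes the dependence
  -- on `t` affine.
  have h2 : y' b = y b := by
    rw [h1, Pi.add_apply, Pi.smul_apply, response_single_eq_zero hG β e 1 b hb, smul_zero, add_zero]
  rw [h2] at h1
  simp only [LinearMap.add_apply, LinearMap.smul_apply, LinearMap.smulRight_apply,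
    LinearMap.comp_apply, LinearMap.proj_apply, smul_smul]
  exact h1

end Transfer

end ADTNetwork

namespace ADTNetwork

/-! ### Rank-maximizing codes attain the cut bound. -/

section Flow

open Module

variable {V I O : Type*} [Fintype I] [Fintype O] {G : ADTNetwork V I O} {K : Type*} [Field K]
  {μ : ℕ}

/-- The rank of the cut `Ω` is at most the dimension of the responses outside of `Ω` to injections
in `Ω`. -/
theorem finrank_range_cutMap_le [Finite V] [DecidableEq O] (hG : G.Acyclic) (β : I → O → K)
    (Ω : Set V) (W : Submodule K (I → K))
    (hW : ∀ o, G.outNode o ∈ Ω → G.inProj Ωᶜ (response hG β (Pi.single o 1)) ∈ W) :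
    finrank K (LinearMap.range (G.cutMap Ω : (O → K) →ₗ[K] (I → K))) ≤ finrank K W := by
  classical
  -- Silencing the relays in `Ω` leaves exactly the injected `z'` on its output ports. The resulting
  -- `y` is also a response under `β` to an injection supported in `Ω`, so its part outside `Ω` lies
  -- in `W`; `Lm` recovers the cut signal from that part.
  let β' : I → O → K := fun b o => if G.outNode o ∈ Ω then 0 else β b o
  let Lm : (I → K) →ₗ[K] (I → K) := G.inProj Ωᶜ ∘ₗ (LinearMap.id - G.edgeMap ∘ₗ G.outMap β')
  suffices H : LinearMap.range (G.cutMap Ω : (O → K) →ₗ[K] (I → K)) ≤ W.map Lm from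
    (Submodule.finrank_mono H).trans (Submodule.finrank_map_le _ _)
  rintro _ ⟨z, rfl⟩
  let z' : O → K := fun o => if G.outNode o ∈ Ω then z o else 0
  set y := response hG β' z' with hy
  have hyeq : y = G.edgeMap (G.outMap β' y + z') := response_eq hG _ _
  let inj : O → K := G.outMap β' y + z' - G.outMap β y
  have hinj : ∀ o, G.outNode o ∉ Ω → inj o = 0 := by
    intro o ho
    simp [inj, z', β', ho, outMap]
  have hy2 : y = response hG β inj := by
    rw [eq_response_iff]
    conv_lhs => rw [hyeq]
    simp [inj]
  have hyW : G.inProj Ωᶜ y ∈ W := by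
    rw [hy2, show inj = ∑ o, inj o • (Pi.single o 1 : O → K) by
      ext o; simp [Finset.sum_apply, Pi.single_apply], map_sum, map_sum]
    refine Submodule.sum_mem _ fun o _ => ?_
    rw [map_smul, map_smul]
    by_cases ho : G.outNode o ∈ Ω
    · exact Submodule.smul_mem _ _ (hW o ho)
    · rw [hinj o ho, zero_smul]; exact Submodule.zero_mem _
  refine ⟨_, hyW, ?_⟩
  have h1 : G.outMap β' (G.inProj Ωᶜ y) = G.outMap β' y := by
    ext o
    refine Finset.sum_congr rfl fun b hb => ?_
    simp only [Finset.mem_filter, Finset.mem_univ, true_and] at hb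
    by_cases ho : G.outNode o ∈ Ω
    · simp [β', ho]
    · simp [inProj, hb, ho]
  ext a
  by_cases ha : G.inNode a ∈ Ω
  · simp [Lm, inProj, cutMap, ha]
  · have h2 : y a = G.edgeMap (G.outMap β' y) a + G.edgeMap z' a := by
      conv_lhs => rw [hyeq]
      simp
    have h3 : Lm (G.inProj Ωᶜ y) a = y a - G.edgeMap (G.outMap β' y) a := by
      simp only [Lm, LinearMap.comp_apply, LinearMap.sub_apply, LinearMap.id_apply, h1]
      simp [inProj, ha]
    rw [h3, h2, add_sub_cancel_left]
    simp [edgeMap, cutMap, z', ha, ← Finset.sum_filter, Finset.filter_filter]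

/-- The transfer map of the code whose coefficients are listed by `p`. -/
noncomputable def codeTransfer [Finite V] (hG : G.Acyclic) (S : V)
    (p : (Fin μ × O) ⊕ (I × O) → K) : (Fin μ → K) →ₗ[K] (I → K) :=
  transfer hG S (fun i e => p (.inl (i, e))) (fun b e => p (.inr (b, e)))

/-- The rank of the transfer map from the source to the nodes in `A`. -/
noncomputable def codeRank [Finite V] (hG : G.Acyclic) (S : V) (A : Set V)
    (p : (Fin μ × O) ⊕ (I × O) → K) : ℕ :=
  finrank K (LinearMap.range (G.inProj A ∘ₗ codeTransfer hG S p))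

theorem codeRank_le [Finite V] (hG : G.Acyclic) (S : V) (A : Set V)
    (p : (Fin μ × O) ⊕ (I × O) → K) : codeRank hG S A p ≤ μ :=
  (LinearMap.finrank_range_le _).trans (by simp)

theorem codeTransfer_source_line [Finite V] [DecidableEq O] (hG : G.Acyclic) {S : V}
    (p p' : (Fin μ × O) ⊕ (I × O) → K) (i : Fin μ) (e : O) (he : G.outNode e = S)
    (h : ∀ w, w ≠ .inl (i, e) → p' w = p w) :
    codeTransfer hG S p' = codeTransfer hG S p + (p' (.inl (i, e)) - p (.inl (i, e))) •
      (LinearMap.proj i : (Fin μ → K) →ₗ[K] K).smulRight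
        (response hG (fun b o => p (.inr (b, o))) (Pi.single e 1)) := by
  have hβ : (fun b o => p' (.inr (b, o))) = fun b o => p (.inr (b, o)) := by
    ext b o; exact h _ (by simp)
  rw [codeTransfer, codeTransfer, hβ]
  refine transfer_add_single_source hG _ _ _ i e he _ fun j o => ?_
  split_ifs with hjo
  · obtain ⟨rfl, rfl⟩ := hjo; ring
  · rw [add_zero]; exact h _ fun heq => hjo (by simpa using heq)

theorem codeTransfer_inner_line [Finite V] [DecidableEq I] [DecidableEq O] (hG : G.Acyclic) (S : V)
    (p p' : (Fin μ × O) ⊕ (I × O) → K) (b : I) (e : O) (hb : G.inNode b = G.outNode e)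
    (h : ∀ w, w ≠ .inr (b, e) → p' w = p w) :
    codeTransfer hG S p' = codeTransfer hG S p + (p' (.inr (b, e)) - p (.inr (b, e))) •
      ((LinearMap.proj b : (I → K) →ₗ[K] K) ∘ₗ codeTransfer hG S p).smulRight
        (response hG (fun b o => p (.inr (b, o))) (Pi.single e 1)) := by
  have hα : (fun i o => p' (.inl (i, o))) = fun i o => p (.inl (i, o)) := by
    ext b o; exact h _ (by simp)
  rw [codeTransfer, codeTransfer, hα]
  refine transfer_add_single hG _ _ _ b e hb _ fun j o => ?_
  split_ifs with hjo
  · obtain ⟨rfl, rfl⟩ := hjo; ring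
  · rw [add_zero]; exact h _ fun heq => hjo (by simpa using heq)

/-- Uniform form of the two perturbation formulas: coefficients joining ports of different nodes
have no effect, so there the direction is zero. -/
theorem exists_codeTransfer_line [Finite V] (hG : G.Acyclic) (S : V)
    (p : (Fin μ × O) ⊕ (I × O) → K) (v : (Fin μ × O) ⊕ (I × O)) :
    ∃ (q : (Fin μ → K) →ₗ[K] K) (h : I → K), ∀ p' : (Fin μ × O) ⊕ (I × O) → K,
      (∀ w, w ≠ v → p' w = p w) →
        codeTransfer hG S p' = codeTransfer hG S p + (p' v - p v) • q.smulRight h := by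
  classical
  rcases v with ⟨i, e⟩ | ⟨b, e⟩
  · by_cases he : G.outNode e = S
    · exact ⟨_, _, fun p' h => codeTransfer_source_line hG p p' i e he h⟩
    · refine ⟨0, 0, fun p' h => ?_⟩
      have hβ : (fun b o => p' (.inr (b, o))) = fun b o => p (.inr (b, o)) := by
        ext b o; exact h _ (by simp)
      have hα : G.srcMap S (fun j o => p' (.inl (j, o))) =
          G.srcMap S (fun j o => p (.inl (j, o))) := by
        refine LinearMap.ext fun x => funext fun o => ?_
        by_cases ho : G.outNode o = S
        · have : ∀ j, p' (.inl (j, o)) = p (.inl (j, o)) := fun j => h _ fun heq => he (by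
            simp only [Sum.inl.injEq, Prod.mk.injEq] at heq
            rwa [← heq.2])
          simp [srcMap, this]
        · simp [srcMap, ho]
      simp [codeTransfer, transfer, hα, hβ]
  · by_cases hb : G.inNode b = G.outNode e
    · exact ⟨_, _, fun p' h => codeTransfer_inner_line hG S p p' b e hb h⟩
    · refine ⟨0, 0, fun p' h => ?_⟩
      have hα : (fun i o => p' (.inl (i, o))) = fun i o => p (.inl (i, o)) := by
        ext b o; exact h _ (by simp)
      have hβ : G.outMap (fun j o => p' (.inr (j, o))) =
          G.outMap (fun j o => p (.inr (j, o))) := by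
        refine LinearMap.ext fun x => funext fun o => ?_
        refine Finset.sum_congr rfl fun a ha => ?_
        simp only [Finset.mem_filter, Finset.mem_univ, true_and] at ha
        have hne : (.inr (a, o) : (Fin μ × O) ⊕ (I × O)) ≠ .inr (b, e) := fun heq => hb (by
          obtain ⟨rfl, rfl⟩ := Prod.mk.inj (Sum.inr.inj heq)
          exact ha)
        simp only [h _ hne]
      have hr : response hG (fun j o => p' (.inr (j, o))) =
          response hG (fun j o => p (.inr (j, o))) := by
        refine LinearMap.ext fun z => ?_
        rw [eq_response_iff, ← hβ]
        exact response_eq hG _ _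
      simp [codeTransfer, transfer, hα, hr]

theorem comp_add_smul_smulRight {E W W' : Type*} [AddCommGroup E] [Module K E] [AddCommGroup W]
    [Module K W] [AddCommGroup W'] [Module K W'] (g : W →ₗ[K] W') (f : E →ₗ[K] W) (u : K)
    (q : E →ₗ[K] K) (h : W) :
    g ∘ₗ (f + u • q.smulRight h) = g ∘ₗ f + u • q.smulRight (g h) := by
  refine LinearMap.ext fun x => ?_
  simp

/-- Every coefficient has at most one value for which the rank drops below `r`, if it is at
least `r` for one value. -/
theorem eq_of_codeRank_lt [Finite V] (hG : G.Acyclic) (S : V) (A : Set V) (r : ℕ)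
    (p : (Fin μ × O) ⊕ (I × O) → K) (p' : K → (Fin μ × O) ⊕ (I × O) → K)
    (v : (Fin μ × O) ⊕ (I × O)) (hp' : ∀ a, (∀ w, w ≠ v → p' a w = p w) ∧ p' a v = a)
    (hp : r ≤ codeRank hG S A p) (a b : K) (ha : ¬ r ≤ codeRank hG S A (p' a))
    (hb : ¬ r ≤ codeRank hG S A (p' b)) : a = b := by
  obtain ⟨q, h, hq⟩ := exists_codeTransfer_line hG S p v
  have hrank : ∀ c, codeRank hG S A (p' c) = finrank K (LinearMap.range
      (G.inProj A ∘ₗ codeTransfer hG S p + (c - p v) • q.smulRight (G.inProj A h))) := by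
    intro c
    rw [← comp_add_smul_smulRight]
    conv_rhs => rw [← (hp' c).2, ← hq (p' c) (hp' c).1]
    rfl
  rw [hrank, not_le] at ha hb
  rw [codeRank] at hp
  generalize G.inProj A ∘ₗ codeTransfer hG S p = f at *
  generalize G.inProj A h = h' at *
  have : a - p v = b - p v := eq_of_finrank_range_add_smulRight_lt f q h' r hp _ _ ha hb
  exact sub_left_inj.1 this

/-- Each set `A` contributes the condition that its rank is the supremum over all codes. There are
finitely many sets, and an infinite field has more elements than that. -/
theorem exists_forall_codeRank_le [Finite V] [Infinite K] (hG : G.Acyclic) (S : V) :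
    ∃ p : (Fin μ × O) ⊕ (I × O) → K, ∀ (A : Set V) (p' : (Fin μ × O) ⊕ (I × O) → K), codeRank hG S A p' ≤ codeRank hG S A p := by
  classical
  have := Fintype.ofFinite V
  obtain ⟨s, hs⟩ := Infinite.exists_subset_card_eq K (Fintype.card (Set V) + 1)
  have hb : ∀ A, BddAbove (Set.range fun p : (Fin μ × O) ⊕ (I × O) → K => codeRank hG S A p) :=
    fun A => ⟨μ, by rintro _ ⟨p, rfl⟩; exact codeRank_le hG S A p⟩
  obtain ⟨p, -, hp⟩ := exists_common_point s (by omega)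
    (fun (A : Set V) p => (⨆ p' : (Fin μ × O) ⊕ (I × O) → K, codeRank hG S A p') ≤
      codeRank hG S A p)
    (fun A p p' v hp' hp a b => eq_of_codeRank_lt hG S A _ p p' v hp' hp a b)
    (fun A => by
      obtain ⟨p, hp⟩ := Nat.sSup_mem (Set.range_nonempty _) (hb A)
      exact ⟨p, hp.ge⟩)
  exact ⟨p, fun A p' => (le_ciSup (hb A) p').trans (hp A)⟩

/-- A code that maximizes all ranks attains the minimum of the cut ranks at every node. -/
theorem le_codeRank_of_forall_cut [Finite V] (hG : G.Acyclic) {S T : V} (hTS : T ≠ S)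
    (p : (Fin μ × O) ⊕ (I × O) → K) (hp : ∀ (A : Set V) (p' : (Fin μ × O) ⊕ (I × O) → K), codeRank hG S A p' ≤ codeRank hG S A p)
    (r : ℕ) (hr : r ≤ μ) (hcut : ∀ Ω : Set V, S ∈ Ω → T ∉ Ω →
      r ≤ finrank K (LinearMap.range (G.cutMap Ω : (O → K) →ₗ[K] (I → K)))) :
    r ≤ codeRank hG S {T} p := by
  classical
  by_contra! hlt
  set f := codeTransfer hG S p with hf
  -- `N` consists of the source vectors invisible at `T`. The cut `Ω` collects `S` and every node
  -- that sees some vector of `N`, so outside `Ω` exactly `N` is invisible and the rank there equals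
  -- the rank at `T`.
  let N := LinearMap.ker (G.inProj {T} ∘ₗ f)
  let Ω : Set V := {w | w = S ∨ ∃ b, G.inNode b = w ∧ ∃ x ∈ N, f x b ≠ 0}
  have hTΩ : T ∉ Ω := by
    rintro (h | ⟨b, hb, x, hx, hxb⟩)
    · exact hTS h
    · apply hxb
      have := congrFun (LinearMap.mem_ker.1 hx) b
      simpa [inProj, hb] using this
  have hker : LinearMap.ker (G.inProj Ωᶜ ∘ₗ f) = N := by
    ext x
    constructor
    · intro hx
      rw [LinearMap.mem_ker] at hx ⊢
      ext b
      by_cases hb : G.inNode b = T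
      · have := congrFun hx b
        simpa [inProj, hb, hTΩ] using this
      · simp [inProj, hb]
    · intro hx
      rw [LinearMap.mem_ker]
      ext b
      by_cases hb : G.inNode b ∈ Ω
      · simp [inProj, hb]
      · have : f x b = 0 := by
          by_contra hxb
          exact hb (Or.inr ⟨b, rfl, x, hx, hxb⟩)
        simp [inProj, this]
  have hrank : codeRank hG S Ωᶜ p = codeRank hG S {T} p := finrank_range_eq_of_ker_eq _ _ hker
  have hkey : ∀ o, G.outNode o ∈ Ω → G.inProj Ωᶜ (response hG (fun b e => p (.inr (b, e)))
      (Pi.single o 1)) ∈ LinearMap.range (G.inProj Ωᶜ ∘ₗ f) := by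
    intro o ho
    by_contra hnot
    -- Some coefficient feeding `o` reads a functional that is nonzero on a vector of `N`.
    -- Perturbing it adds a direction outside the range and would raise a maximal rank.
    obtain ⟨v, q, x, hq, hxN, hqx⟩ : ∃ (v : (Fin μ × O) ⊕ (I × O)) (q : (Fin μ → K) →ₗ[K] K)
        (x : Fin μ → K), (∀ p' : (Fin μ × O) ⊕ (I × O) → K, (∀ w, w ≠ v → p' w = p w) →
          codeTransfer hG S p' = f + (p' v - p v) •
            q.smulRight (response hG (fun b e => p (.inr (b, e))) (Pi.single o 1))) ∧
        x ∈ N ∧ q x ≠ 0 := by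
      rcases ho with ho | ⟨b, hb, x, hx, hxb⟩
      · have hN : N ≠ ⊥ := by
          intro hN
          have h1 := (G.inProj {T} ∘ₗ f).finrank_range_add_finrank_ker
          change codeRank hG S {T} p + finrank K N = _ at h1
          rw [hN, finrank_bot, Module.finrank_fin_fun] at h1
          omega
        obtain ⟨x, hx, hx0⟩ := Submodule.exists_mem_ne_zero_of_ne_bot hN
        obtain ⟨i, hi⟩ := Function.ne_iff.1 hx0
        exact ⟨_, _, x, fun p' h => codeTransfer_source_line hG p p' i o ho h, hx, hi⟩
      · exact ⟨_, _, x, fun p' h => codeTransfer_inner_line hG S p p' b o hb h, hx, hxb⟩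
    have h1 := hq (Function.update p v (p v + 1)) fun w hw => by simp [hw]
    rw [Function.update_self, add_sub_cancel_left] at h1
    have h2 := hp Ωᶜ (Function.update p v (p v + 1))
    rw [codeRank, h1, comp_add_smul_smulRight, codeRank, ← hf] at h2
    rw [← hker, LinearMap.mem_ker] at hxN
    have h3 := finrank_range_add_smulRight (G.inProj Ωᶜ ∘ₗ f) q _ 1 one_ne_zero x hxN hqx hnot
    omega
  have h1 := finrank_range_cutMap_le hG _ Ω _ hkey
  have h2 := hcut Ω (Or.inl rfl) hTΩ
  change _ ≤ codeRank hG S Ωᶜ p at h1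
  omega

end Flow

end ADTNetwork

/-! ### Invariance of the rank of a linear map under field extension. -/

section BaseChange

open Module

theorem finrank_range_comp_comp_le {K E₁ E₂ E₃ E₄ : Type*} [Field K] [AddCommGroup E₁] [Module K E₁]
    [AddCommGroup E₂] [Module K E₂] [FiniteDimensional K E₂] [AddCommGroup E₃] [Module K E₃]
    [AddCommGroup E₄] [Module K E₄]
    (g : E₃ →ₗ[K] E₄) (f : E₂ →ₗ[K] E₃) (h : E₁ →ₗ[K] E₂) :
    finrank K (LinearMap.range (g ∘ₗ f ∘ₗ h)) ≤ finrank K (LinearMap.range f) := by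
  have : LinearMap.range (g ∘ₗ f ∘ₗ h) ≤ (LinearMap.range f).map g := by
    rintro _ ⟨x, rfl⟩
    exact ⟨_, ⟨h x, rfl⟩, rfl⟩
  exact (Submodule.finrank_mono this).trans (Submodule.finrank_map_le _ _)

theorem finrank_range_eq_of_algebraMap {m n F K : Type*} [Fintype m] [Fintype n] [Field F] [Field K]
    [Algebra F K] (f : (m → F) →ₗ[F] (n → F)) (g : (m → K) →ₗ[K] (n → K))
    (h : ∀ x, g (algebraMap F K ∘ x) = algebraMap F K ∘ f x) :
    finrank K (LinearMap.range g) = finrank F (LinearMap.range f) := by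
  classical
  have h1 : LinearMap.toMatrix' g = (LinearMap.toMatrix' f).map (algebraMap F K) := by
    ext i j
    have h2 := congrFun (h (Pi.single j 1)) i
    have h3 : algebraMap F K ∘ (Pi.single j 1 : m → F) = Pi.single j 1 := by
      ext k
      by_cases hk : k = j
      · subst hk; simp
      · simp [hk]
    rw [h3] at h2
    simpa [LinearMap.toMatrix'_apply] using h2
  have h4 := Matrix.rank_map_algebraMap (K := K) (LinearMap.toMatrix' f)
  rw [← h1, Matrix.rank, Matrix.rank, ← Matrix.toLin'_apply', ← Matrix.toLin'_apply',
    Matrix.toLin'_toMatrix', Matrix.toLin'_toMatrix'] at h4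
  exact h4

end BaseChange

namespace ADTNetwork

/-! ### Codes over a finite field attaining the cut bounds, and `mincut` in terms of `cutMap`. -/

section Multicast

open Module

variable {V I O : Type*} [Fintype I] [Fintype O] {G : ADTNetwork V I O}

theorem finrank_range_cutMap_eq (F K : Type*) [Field F] [Field K] [Algebra F K] (Ω : Set V) :
    finrank K (LinearMap.range (G.cutMap Ω : (O → K) →ₗ[K] (I → K))) =
      finrank F (LinearMap.range (G.cutMap Ω : (O → F) →ₗ[F] (I → F))) :=
  finrank_range_eq_of_algebraMap _ _ fun x => by ext a; simp [cutMap]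

omit [Fintype I] in
theorem edgeMap_algebraMap (F K : Type*) [Field F] [Field K] [Algebra F K] (z : O → F) :
    G.edgeMap (algebraMap F K ∘ z) = algebraMap F K ∘ G.edgeMap z := by
  ext a; simp [edgeMap]

omit [Fintype O] in
theorem outMap_algebraMap (F K : Type*) [Field F] [Field K] [Algebra F K] (β : I → O → F)
    (y : I → F) : G.outMap (fun b e => algebraMap F K (β b e)) (algebraMap F K ∘ y) =
      algebraMap F K ∘ G.outMap β y := by
  ext a; simp [outMap]

theorem response_algebraMap [Finite V] (F K : Type*) [Field F] [Field K] [Algebra F K]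
    (hG : G.Acyclic) (β : I → O → F) (z : O → F) :
    response hG (fun b e => algebraMap F K (β b e)) (algebraMap F K ∘ z) =
      algebraMap F K ∘ response hG β z := by
  symm
  rw [eq_response_iff, outMap_algebraMap]
  conv_lhs => rw [response_eq, ← edgeMap_algebraMap]
  congr 1
  ext o
  simp

omit [Fintype I] [Fintype O] in
theorem srcMap_algebraMap (F K : Type*) [Field F] [Field K] [Algebra F K] (S : V) {μ : ℕ}
    (α : Fin μ → O → F) (x : Fin μ → F) :
    G.srcMap S (fun i e => algebraMap F K (α i e)) (algebraMap F K ∘ x) =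
      algebraMap F K ∘ G.srcMap S α x := by
  ext o
  by_cases ho : G.outNode o = S <;> simp [srcMap, ho]

theorem codeTransfer_algebraMap [Finite V] (F K : Type*) [Field F] [Field K] [Algebra F K]
    (hG : G.Acyclic) (S : V) {μ : ℕ} (p : (Fin μ × O) ⊕ (I × O) → F) (x : Fin μ → F) :
    codeTransfer hG S (algebraMap F K ∘ p) (algebraMap F K ∘ x) =
      algebraMap F K ∘ codeTransfer hG S p x := by
  rw [codeTransfer, codeTransfer, transfer, transfer, LinearMap.comp_apply, LinearMap.comp_apply,
    ← response_algebraMap, ← srcMap_algebraMap]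
  rfl

theorem codeRank_algebraMap [Finite V] (F K : Type*) [Field F] [Field K] [Algebra F K]
    (hG : G.Acyclic) (S : V) {μ : ℕ} (A : Set V) (p : (Fin μ × O) ⊕ (I × O) → F) :
    codeRank hG S A (algebraMap F K ∘ p) = codeRank hG S A p :=
  finrank_range_eq_of_algebraMap _ _ fun x => by
    rw [LinearMap.comp_apply, codeTransfer_algebraMap]
    ext a
    by_cases ha : G.inNode a ∈ A <;> simp [inProj, ha]

/-- Over a field with more elements than there are receivers, one code attains the cut bounds at
all receivers. -/
theorem exists_forall_le_codeRank [Finite V] {F : Type*} [Field F] [Fintype F] (hG : G.Acyclic)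
    (S : V) {μ : ℕ} {ι : Type*} [Fintype ι] (hcard : Fintype.card ι < Fintype.card F) (R : ι → V)
    (hR : ∀ i, R i ≠ S) (r : ι → ℕ) (hr : ∀ i, r i ≤ μ)
    (hcut : ∀ i (Ω : Set V), S ∈ Ω → R i ∉ Ω →
      r i ≤ finrank F (LinearMap.range (G.cutMap Ω : (O → F) →ₗ[F] (I → F)))) :
    ∃ p : (Fin μ × O) ⊕ (I × O) → F, ∀ i, r i ≤ codeRank hG S {R i} p := by
  classical
  -- The infinite field supplies a good code for each receiver. The common code is then picked with
  -- all coefficients in the image of `F`.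
  let K := AlgebraicClosure F
  have : Infinite K := IsAlgClosed.instInfinite
  obtain ⟨p₁, hp₁⟩ := exists_forall_codeRank_le (K := K) (μ := μ) hG S
  obtain ⟨p, hps, hp⟩ := exists_common_point (Finset.univ.image (algebraMap F K))
    (by rwa [Finset.card_image_of_injective _ (algebraMap F K).injective, Finset.card_univ])
    (fun i p => r i ≤ codeRank (μ := μ) hG S {R i} p)
    (fun i p p' v hp' hp a b => eq_of_codeRank_lt hG S _ _ p p' v hp' hp a b)
    (fun i => ⟨p₁, le_codeRank_of_forall_cut hG (hR i) p₁ hp₁ (r i) (hr i) fun Ω h1 h2 => by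
      rw [finrank_range_cutMap_eq F K]; exact hcut i Ω h1 h2⟩)
  simp only [Finset.mem_image, Finset.mem_univ, true_and] at hps
  choose p₀ hp₀ using hps
  obtain rfl : algebraMap F K ∘ p₀ = p := funext hp₀
  exact ⟨p₀, fun i => by rw [← codeRank_algebraMap F K]; exact hp i⟩

theorem rank_cutMatrix [DecidableEq V] (F : Type*) [Field F] (Ω : Finset V) :
    (G.cutMatrix F Ω).rank =
      finrank F (LinearMap.range (G.cutMap (Ω : Set V) : (O → F) →ₗ[F] (I → F))) := by
  classical
  rw [← Matrix.rank_transpose, Matrix.rank]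
  set M := (G.cutMatrix F Ω).transpose.mulVecLin with hM
  have hMa : ∀ z a, M z a = ∑ e, (if G.edge e.1 a.1 then 1 else 0) * z e := fun z a => by
    simp only [hM, Matrix.mulVecLin_apply, Matrix.mulVec, dotProduct, cutMatrix,
      Matrix.transpose_apply, Matrix.of_apply]
  let eO : ({e : O // G.outNode e ∈ Ω} → F) →ₗ[F] (O → F) :=
    Function.ExtendByZero.linearMap F Subtype.val
  let eI : ({e : I // G.inNode e ∉ Ω} → F) →ₗ[F] (I → F) :=
    Function.ExtendByZero.linearMap F Subtype.val
  let rO : (O → F) →ₗ[F] ({e : O // G.outNode e ∈ Ω} → F) := LinearMap.funLeft F F Subtype.val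
  let rI : (I → F) →ₗ[F] ({e : I // G.inNode e ∉ Ω} → F) := LinearMap.funLeft F F Subtype.val
  have h1 : M ∘ₗ rO = rI ∘ₗ G.cutMap (Ω : Set V) := by
    refine LinearMap.ext fun z => funext fun a => ?_
    simp only [LinearMap.comp_apply, hMa, rO, rI, LinearMap.funLeft_apply, cutMap,
      LinearMap.coe_mk, AddHom.coe_mk, Finset.mem_coe, a.2, not_false_eq_true, and_true,
      Finset.sum_filter]
    simp only [ite_mul, one_mul, zero_mul, and_comm (a := G.edge _ _), ite_and]
    rw [← Finset.sum_filter (fun e => G.outNode e ∈ Ω)]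
    exact (Finset.sum_subtype _ (by simp) fun e => if G.edge e a.1 then z e else 0).symm
  have h2 : rO ∘ₗ eO = LinearMap.id := by
    refine LinearMap.ext fun z => funext fun a => ?_
    simp [rO, eO, LinearMap.funLeft_apply]
  have h3 : eI ∘ₗ rI ∘ₗ (G.cutMap (Ω : Set V) : (O → F) →ₗ[F] (I → F)) = G.cutMap (Ω : Set V) := by
    refine LinearMap.ext fun z => funext fun a => ?_
    simp only [LinearMap.comp_apply, eI, Function.ExtendByZero.linearMap_apply]
    by_cases ha : G.inNode a ∈ Ω
    · rw [Function.extend_apply' _ _ _ (by rintro ⟨b, rfl⟩; exact b.2 ha)]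
      simp [cutMap, ha]
    · exact Subtype.val_injective.extend_apply _ _ (⟨a, ha⟩ : {e : I // G.inNode e ∉ Ω})
  apply le_antisymm
  · have := finrank_range_comp_comp_le rI (G.cutMap (Ω : Set V)) eO
    rwa [← LinearMap.comp_assoc, ← h1, LinearMap.comp_assoc, h2, LinearMap.comp_id] at this
  · have := finrank_range_comp_comp_le eI M rO
    rwa [h1, h3] at this

theorem le_mincut_iff [Finite V] [DecidableEq V] (F : Type*) [Field F] (S : V) (D : Finset V) (hS : S ∉ D)
    (n : ℕ) : n ≤ G.mincut F S D ↔ ∀ Ω : Set V, S ∈ Ω → (∀ v ∈ D, v ∉ Ω) →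
      n ≤ finrank F (LinearMap.range (G.cutMap Ω : (O → F) →ₗ[F] (I → F))) := by
  classical
  have := Fintype.ofFinite V
  constructor
  · intro h Ω hSΩ hD
    have h1 := rank_cutMatrix (G := G) F Ω.toFinset
    rw [Set.coe_toFinset] at h1
    rw [← h1]
    refine h.trans (Nat.sInf_le ⟨Ω.toFinset, by simpa using hSΩ, ?_, rfl⟩)
    exact Finset.disjoint_left.2 fun v hv => by simpa using hD v hv
  · intro h
    refine le_csInf ⟨_, {S}, by simp, by simpa using hS, rfl⟩ ?_
    rintro _ ⟨Ω, hSΩ, hD, rfl⟩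
    rw [rank_cutMatrix]
    exact h Ω (by simpa using hSΩ) fun v hv => by simpa using Finset.disjoint_left.1 hD hv

end Multicast

end ADTNetwork

namespace ADTNetwork

/-! ### Solvability: the cut bound and a decoding criterion. -/

section Solvability

open Module

variable {V I O : Type*} [Fintype I] [Fintype O] {G : ADTNetwork V I O} {K : Type*} [Field K]
  {μ : ℕ}

/-- The number of processes requested outside of a cut is at most the rank of the cut. -/
theorem SolvableOver.card_le_cut [Finite V] (hG : G.Acyclic) {S : V} {C : Set (Connection V μ)}
    (h : G.SolvableOver K S C) (Ω : Set V) (hS : S ∈ Ω) (U : Finset (Fin μ))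
    (hU : ∀ i ∈ U, ∃ d ∈ C, d.dest ∉ Ω ∧ i ∈ d.demand) :
    U.card ≤ finrank K (LinearMap.range (G.cutMap Ω : (O → K) →ₗ[K] (I → K))) := by
  obtain ⟨c, hc⟩ := h
  let t := transfer hG S c.α c.β
  let w : (Fin μ → K) →ₗ[K] (O → K) := G.outMap c.β ∘ₗ t + G.srcMap S c.α
  let ψ : (Fin μ → K) →ₗ[K] (U → K) := LinearMap.funLeft K K Subtype.val
  have hψ : LinearMap.range ψ = ⊤ :=
    LinearMap.range_eq_top.2 (LinearMap.funLeft_surjective_of_injective _ _ _ Subtype.val_injective)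
  -- Source vectors that send nothing across the cut have zero coordinates on `U`, since those are
  -- decoded from silent ports.
  have hker : LinearMap.ker (G.cutMap Ω ∘ₗ w) ≤ LinearMap.ker ψ := by
    intro x hx
    rw [LinearMap.mem_ker] at hx ⊢
    obtain ⟨yIn, yOut, ht, hd⟩ := hc x
    have hy : yIn = t x := ht.eq_transfer hG
    obtain ⟨h1, h2⟩ := isTransmission_iff.1 ht
    have h3 : yOut = w x := by rw [h1, hy]; rfl
    have h0 := eq_zero_of_cutMap_eq_zero hG h1 h2 Ω (fun e he => by
      have : G.outNode e ≠ S := fun h => he (h ▸ hS)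
      simp [srcMap, this]) (by rw [h3]; exact hx)
    ext ⟨i, hi⟩
    obtain ⟨d, hdC, hdΩ, hid⟩ := hU i hi
    change x i = 0
    rw [← hd d hdC i hid, output]
    refine Finset.sum_eq_zero fun b hb => ?_
    simp only [Finset.mem_filter, Finset.mem_univ, true_and] at hb
    rw [h0 b (hb ▸ hdΩ), mul_zero]
  have h1 := Submodule.finrank_mono hker
  have h2 := ψ.finrank_range_add_finrank_ker
  have h3 := (G.cutMap Ω ∘ₗ w).finrank_range_add_finrank_ker
  have h4 := finrank_range_comp_comp_le LinearMap.id (G.cutMap Ω : (O → K) →ₗ[K] (I → K)) w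
  rw [LinearMap.id_comp] at h4
  rw [hψ, finrank_top, Module.finrank_fintype_fun_eq_card, Fintype.card_coe] at h2
  omega

open Classical in
theorem solvableOver_of_decodable [Finite V] (hG : G.Acyclic) {S : V} {C : Set (Connection V μ)}
    (α : Fin μ → O → K) (β : I → O → K) (h : ∀ d ∈ C, ∀ i ∈ d.demand, ∃ η : I → K, ∀ x,
      ∑ b with G.inNode b = d.dest, η b * transfer hG S α β x b = x i) : G.SolvableOver K S C := by
  let Q : V → Fin μ → (I → K) → Prop := fun t i η =>
    ∀ x, ∑ b with G.inNode b = t, η b * transfer hG S α β x b = x i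
  let c : LinearCode V I O μ K := ⟨α, β, fun t i => if h : ∃ η, Q t i η then h.choose else 0⟩
  refine ⟨c, fun x => ⟨_, _, isTransmission_transfer hG S c x, fun d hd i hi => ?_⟩⟩
  have hex : ∃ η, Q d.dest i η := h d hd i hi
  have hε : c.ε d.dest i = hex.choose := dif_pos hex
  rw [output, hε]
  exact hex.choose_spec x

end Solvability

/-! ### The network with a super-sink. -/

section SuperSink

open Module

variable {V I O P : Type*}

/-- The network with an additional node `none` which receives, for every `p`, one symbol
from the node `T p` over a private edge. -/
def withSink (G : ADTNetwork V I O) (T : P → V) : ADTNetwork (Option V) (I ⊕ P) (O ⊕ P) where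
  inNode := Sum.elim (some ∘ G.inNode) fun _ => none
  outNode := Sum.elim (some ∘ G.outNode) (some ∘ T)
  edge
    | .inl e, .inl a => G.edge e a
    | .inr p, .inr p' => p = p'
    | _, _ => False

variable {G : ADTNetwork V I O} {T : P → V}

theorem Acyclic.withSink (hG : G.Acyclic) (T : P → V) : (G.withSink T).Acyclic := by
  have h0 : ∀ w, ¬ (G.withSink T).Adj none w := by
    rintro w ⟨e | e, a, h, -⟩ <;> cases h
  have h1 : ∀ v w, (G.withSink T).Adj (some v) (some w) → G.Adj v w := by
    rintro v w ⟨e | e, a | a, h1, h2, h3⟩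
    · exact ⟨e, a, Option.some.inj h1, Option.some.inj h2, h3⟩
    · cases h3
    · cases h3
    · cases h2
  have h2 : ∀ x y, Relation.TransGen (G.withSink T).Adj x y → ∀ v w, x = some v → y = some w →
      Relation.TransGen G.Adj v w := by
    intro x y h
    induction h with
    | single h =>
      rintro v w rfl rfl
      exact .single (h1 _ _ h)
    | @tail b c _ h ih =>
      rintro v w rfl rfl
      cases b with
      | none => exact absurd h (h0 _)
      | some b => exact (ih v b rfl rfl).tail (h1 _ _ h)
  rintro (_ | v) h
  · obtain ⟨w, h, -⟩ := Relation.TransGen.head'_iff.1 h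
    exact h0 _ h
  · exact hG v (h2 _ _ h v v rfl rfl)

variable [Fintype I] [Fintype O] [Fintype P] {K : Type*} [Field K]

omit [Fintype I] in
open Classical in
theorem edgeMap_apply (z : O → K) (a : I) :
    G.edgeMap z a = ∑ e, if G.edge e a then z e else 0 :=
  Finset.sum_filter _ _

omit [Fintype O] in
open Classical in
theorem outMap_apply (β : I → O → K) (y : I → K) (e : O) :
    G.outMap β y e = ∑ b, if G.inNode b = G.outNode e then β b e * y b else 0 :=
  Finset.sum_filter _ _

omit [Fintype I] in
open Classical in
theorem cutMap_apply (Ω : Set V) (z : O → K) (a : I) :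
    G.cutMap Ω z a =
      ∑ e, if G.edge e a ∧ G.outNode e ∈ Ω ∧ G.inNode a ∉ Ω then z e else 0 :=
  Finset.sum_filter _ _

omit [Fintype I] in
theorem withSink_edgeMap_inl (z : O ⊕ P → K) (a : I) :
    (G.withSink T).edgeMap z (.inl a) = G.edgeMap (z ∘ Sum.inl) a := by
  classical
  rw [edgeMap_apply, Fintype.sum_sum_type]
  have h1 : ∀ p, ¬ (G.withSink T).edge (.inr p) (.inl a) := fun _ h => h
  have h2 : ∀ e, (G.withSink T).edge (.inl e) (.inl a) ↔ G.edge e a := fun _ => Iff.rfl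
  simp [h1, h2, edgeMap_apply]

omit [Fintype I] in
theorem withSink_edgeMap_inr (z : O ⊕ P → K) (p : P) :
    (G.withSink T).edgeMap z (.inr p) = z (.inr p) := by
  classical
  rw [edgeMap_apply, Fintype.sum_sum_type]
  have h1 : ∀ e, ¬ (G.withSink T).edge (.inl e) (.inr p) := fun _ h => h
  have h2 : ∀ p', (G.withSink T).edge (.inr p') (.inr p) ↔ p' = p := fun _ => Iff.rfl
  simp [h1, h2]

omit [Fintype O] in
theorem withSink_outMap_inl (β : I ⊕ P → O ⊕ P → K) (y : I ⊕ P → K) (e : O) :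
    (G.withSink T).outMap β y (.inl e) =
      G.outMap (fun b e => β (.inl b) (.inl e)) (y ∘ Sum.inl) e := by
  classical
  rw [outMap_apply, Fintype.sum_sum_type]
  simp [outMap_apply, withSink]

omit [Fintype O] in
open Classical in
theorem withSink_outMap_inr (β : I ⊕ P → O ⊕ P → K) (y : I ⊕ P → K) (p : P) :
    (G.withSink T).outMap β y (.inr p) =
      ∑ b with G.inNode b = T p, β (.inl b) (.inr p) * y (.inl b) := by
  rw [outMap_apply, Fintype.sum_sum_type]
  simp [Finset.sum_filter, withSink]

theorem withSink_response_inl [Finite V] (hG : G.Acyclic) (β : I ⊕ P → O ⊕ P → K)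
    (z : O ⊕ P → K) : response (hG.withSink T) β z ∘ Sum.inl =
      response hG (fun b e => β (.inl b) (.inl e)) (z ∘ Sum.inl) := by
  rw [eq_response_iff]
  conv_lhs => rw [response_eq]
  ext a
  rw [Function.comp_apply, withSink_edgeMap_inl]
  refine congrArg (fun w => G.edgeMap w a) ?_
  ext e
  simp [withSink_outMap_inl]

omit [Fintype I] in
theorem withSink_cutMap_inl (Ω : Set (Option V)) (z : O ⊕ P → K) (a : I) :
    (G.withSink T).cutMap Ω z (.inl a) = G.cutMap (some ⁻¹' Ω) (z ∘ Sum.inl) a := by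
  classical
  rw [cutMap_apply, Fintype.sum_sum_type]
  simp [cutMap_apply, withSink]
  congr!

omit [Fintype I] in
open Classical in
theorem withSink_cutMap_inr (Ω : Set (Option V)) (hΩ : none ∉ Ω) (z : O ⊕ P → K) (p : P) :
    (G.withSink T).cutMap Ω z (.inr p) = if some (T p) ∈ Ω then z (.inr p) else 0 := by
  rw [cutMap_apply, Fintype.sum_sum_type]
  simp [withSink, hΩ, ite_and]

-- Discarding the private edges leaves the cut of the original network. This serves the receivers
-- `T' l`, for which the sink may lie on either side.
omit [Fintype I] in
theorem finrank_range_cutMap_le_withSink (Ω : Set (Option V)) :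
    finrank K (LinearMap.range (G.cutMap (some ⁻¹' Ω) : (O → K) →ₗ[K] (I → K))) ≤
      finrank K (LinearMap.range ((G.withSink T).cutMap Ω : (O ⊕ P → K) →ₗ[K] (I ⊕ P → K))) := by
  let i : (O → K) →ₗ[K] (O ⊕ P → K) :=
    (LinearEquiv.sumArrowLequivProdArrow O P K K).symm.toLinearMap ∘ₗ LinearMap.inl K _ _
  have h : G.cutMap (some ⁻¹' Ω) =
      LinearMap.funLeft K K Sum.inl ∘ₗ (G.withSink T).cutMap Ω ∘ₗ i := by
    refine LinearMap.ext fun z => funext fun a => ?_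
    simp only [LinearMap.comp_apply, LinearMap.funLeft_apply, withSink_cutMap_inl]
    rfl
  rw [h]
  exact finrank_range_comp_comp_le _ _ _

-- With the sink outside `Ω`, the private edges from nodes in `Ω` form an identity block that shares
-- no ports with the cut of `G`, so the ranks add.
omit [Fintype I] in
theorem finrank_range_cutMap_add_card_le_withSink (Ω : Set (Option V)) (hΩ : none ∉ Ω) :
    finrank K (LinearMap.range (G.cutMap (some ⁻¹' Ω) : (O → K) →ₗ[K] (I → K))) +
      Nat.card {p : P // some (T p) ∈ Ω} ≤
      finrank K (LinearMap.range ((G.withSink T).cutMap Ω : (O ⊕ P → K) →ₗ[K] (I ⊕ P → K))) := by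
  classical
  let f : (O → K) →ₗ[K] (I → K) := G.cutMap (some ⁻¹' Ω)
  let e := LinearEquiv.sumArrowLequivProdArrow I P K K
  let ex : ({p : P // some (T p) ∈ Ω} → K) →ₗ[K] (P → K) :=
    Function.ExtendByZero.linearMap K Subtype.val
  have hex : Function.Injective ex := Function.extend_injective Subtype.val_injective (0 : P → K)
  let Φ : LinearMap.range f × ({p : P // some (T p) ∈ Ω} → K) →ₗ[K] (I ⊕ P → K) :=
    e.symm.toLinearMap ∘ₗ (LinearMap.range f).subtype.prodMap ex
  have hΦ : Function.Injective Φ :=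
    e.symm.injective.comp (Function.Injective.prodMap (Submodule.subtype_injective _) hex)
  have hle : LinearMap.range Φ ≤ LinearMap.range
      ((G.withSink T).cutMap Ω : (O ⊕ P → K) →ₗ[K] (I ⊕ P → K)) := by
    rintro _ ⟨⟨⟨_, z, rfl⟩, w⟩, rfl⟩
    refine ⟨Sum.elim z (ex w), ?_⟩
    ext (a | p)
    · rw [withSink_cutMap_inl]
      rfl
    · rw [withSink_cutMap_inr Ω hΩ]
      change (if some (T p) ∈ Ω then ex w p else 0) = ex w p
      split_ifs with hp
      · rfl
      · rw [Function.ExtendByZero.linearMap_apply, Function.extend_apply']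
        · rfl
        · rintro ⟨b, rfl⟩
          exact hp b.2
  have h1 := Submodule.finrank_mono hle
  rw [LinearMap.finrank_range_of_inj hΦ, Module.finrank_prod, Module.finrank_fintype_fun_eq_card,
    ← Nat.card_eq_fintype_card] at h1
  exact h1

end SuperSink

end ADTNetwork

namespace ADTNetwork

/-! ### Two-level multicast. -/

section TwoLevel

open Module

variable {V I O : Type*} [Fintype I] [Fintype O] {G : ADTNetwork V I O} {μ K L : ℕ}

theorem linearMap_apply_eq_sum_single {F m n : Type*} [Field F] [Fintype m] [DecidableEq m]
    (f : (m → F) →ₗ[F] (n → F)) (x : m → F) (i : n) :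
    f x i = ∑ j, x j * f (Pi.single j 1) i := by
  conv_lhs => rw [← Finset.univ_sum_single x, map_sum, Finset.sum_apply]
  refine Finset.sum_congr rfl fun j _ => ?_
  rw [← smul_eq_mul, ← Pi.smul_apply, ← map_smul, ← Pi.single_smul, smul_eq_mul, mul_one]

theorem mincut_eq [Finite V] [DecidableEq V] (F F' : Type*) [Field F] [Field F'] [Algebra F F']
    (S : V) (D : Finset V) : G.mincut F' S D = G.mincut F S D := by
  simp only [mincut, rank_cutMatrix, finrank_range_cutMap_eq F F']

theorem SolvableOver.twoLevelCutConditions [Finite V] [DecidableEq V] {F : Type*} [Field F]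
    (hG : G.Acyclic) {S : V} {T : Fin K → V} {T' : Fin L → V} (hT : ∀ k, T k ≠ S)
    (hT' : ∀ l, T' l ≠ S) {X : Fin K → Finset (Fin μ)}
    (hX : ∀ k₁ k₂, k₁ ≠ k₂ → Disjoint (X k₁) (X k₂))
    (h : G.SolvableOver F S (twoLevelConnections T X T')) :
    TwoLevelCutConditions G F S T X T' := by
  refine ⟨fun J => ?_, fun l => ?_⟩
  · rw [le_mincut_iff F S _ (by simpa using fun k _ => hT k)]
    intro Ω hS hΩ
    rw [← Finset.card_biUnion fun k₁ _ k₂ _ h => hX k₁ k₂ h]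
    refine h.card_le_cut hG Ω hS _ fun i hi => ?_
    obtain ⟨k, hk, hik⟩ := Finset.mem_biUnion.1 hi
    exact ⟨⟨T k, X k⟩, Or.inl ⟨k, rfl⟩, hΩ _ (Finset.mem_image_of_mem _ hk), hik⟩
  · rw [le_mincut_iff F S _ (by simpa using (hT' l).symm)]
    intro Ω hS hΩ
    have := h.card_le_cut hG Ω hS Finset.univ fun i _ =>
      ⟨⟨T' l, Finset.univ⟩, Or.inr ⟨l, rfl⟩, hΩ _ (Finset.mem_singleton_self _), Finset.mem_univ i⟩
    simpa using this

/-- Under the cut conditions, some code delivers independent combinations of the source symbols,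
as many as they request in total, to the nodes `T k`, and all source symbols to the nodes `T' l`. -/
theorem exists_code_of_twoLevelCutConditions [Finite V] [DecidableEq V] {F : Type*} [Field F]
    [Fintype F] (hG : G.Acyclic) {S : V} {T : Fin K → V} {T' : Fin L → V} (hT : ∀ k, T k ≠ S)
    (hT' : ∀ l, T' l ≠ S) {X : Fin K → Finset (Fin μ)}
    (hX : Function.Injective fun p : Σ k, X k => (p.2 : Fin μ))
    (hcard : K + L < Fintype.card F) (h : TwoLevelCutConditions G F S T X T') :
    ∃ p : (Fin μ × (O ⊕ Σ k, X k)) ⊕ ((I ⊕ Σ k, X k) × (O ⊕ Σ k, X k)) → F,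
      (Fintype.card (Σ k, X k) ≤
        codeRank (hG.withSink fun p : Σ k, X k => T p.1) (some S) {none} p) ∧
      ∀ l, μ ≤ codeRank (hG.withSink fun p : Σ k, X k => T p.1) (some S) {some (T' l)} p := by
  classical
  obtain ⟨hJ, hL⟩ := h
  have hP : Fintype.card (Σ k, X k) = ∑ k, (X k).card := by simp
  -- The sink is listed once per `k : Fin K`, so that there are exactly `K + L` receivers; for `K =
  -- 0` it is absent, and its rank condition is then trivial.
  obtain ⟨p, hp⟩ := exists_forall_le_codeRank (F := F) (μ := μ) (ι := Fin L ⊕ Fin K)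
    (hG.withSink fun p : Σ k, X k => T p.1) (some S) (by simpa [add_comm] using hcard)
    (Sum.elim (fun l => some (T' l)) fun _ => none) (by rintro (l | k) <;> simp [hT'])
    (Sum.elim (fun _ => μ) fun _ => Fintype.card (Σ k, X k)) (by
      rintro (l | k)
      · simp
      · exact (Fintype.card_le_of_injective _ hX).trans (by simp))
    (by
      rintro (l | k) Ω hS hR
      · refine le_trans ?_ (finrank_range_cutMap_le_withSink Ω)
        refine (le_mincut_iff F S _ (by simpa using (hT' l).symm) _).1 (hL l) (some ⁻¹' Ω) hS ?_
        simpa using hR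
      · refine le_trans ?_ (finrank_range_cutMap_add_card_le_withSink Ω hR)
        -- Requests from nodes outside `Ω` are covered by the cut condition for `J`, the remaining
        -- ones by the private edges crossing the cut.
        let J := Finset.univ.filter fun k => some (T k) ∉ Ω
        have h1 := (le_mincut_iff F S _ (by simpa using fun k _ => hT k) _).1 (hJ J) (some ⁻¹' Ω) hS
          (by simp [J])
        have h2 : Nat.card {p : Σ k, X k // some (T p.1) ∈ Ω} = ∑ k ∈ Jᶜ, (X k).card := by
          rw [Nat.card_eq_fintype_card, Fintype.card_subtype, Finset.card_filter,
            Fintype.sum_sigma, show Jᶜ = Finset.univ.filter fun k => some (T k) ∈ Ω by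
              ext; simp [J], Finset.sum_filter]
          refine Finset.sum_congr rfl fun k _ => ?_
          by_cases hk : some (T k) ∈ Ω <;> simp [hk]
        rw [h2]
        change Fintype.card (Σ k, X k) ≤ _
        rw [hP, ← Finset.sum_add_sum_compl J]
        gcongr)
  refine ⟨p, ?_, fun l => hp (.inl l)⟩
  rcases isEmpty_or_nonempty (Fin K) with hK | ⟨⟨k⟩⟩
  · rw [hP]
    simp
  · exact hp (.inr k)

theorem solvableOver_of_twoLevelCutConditions [Finite V] [DecidableEq V] {F : Type*} [Field F]
    [Fintype F] (hG : G.Acyclic) {S : V} {T : Fin K → V} {T' : Fin L → V} (hT : ∀ k, T k ≠ S)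
    (hT' : ∀ l, T' l ≠ S) {X : Fin K → Finset (Fin μ)}
    (hX : ∀ k₁ k₂, k₁ ≠ k₂ → Disjoint (X k₁) (X k₂))
    (hcard : K + L < Fintype.card F) (h : TwoLevelCutConditions G F S T X T') :
    G.SolvableOver F S (twoLevelConnections T X T') := by
  classical
  have hinj : Function.Injective fun p : Σ k, X k => (p.2 : Fin μ) := by
    rintro ⟨k₁, i₁, h₁⟩ ⟨k₂, i₂, h₂⟩ (rfl : i₁ = i₂)
    obtain rfl : k₁ = k₂ := by
      by_contra hk
      exact Finset.disjoint_left.1 (hX _ _ hk) h₁ h₂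
    rfl
  obtain ⟨p, hp, hp'⟩ := exists_code_of_twoLevelCutConditions hG hT hT' hinj hcard h
  set hG' := hG.withSink fun p : Σ k, X k => T p.1
  let β' : (I ⊕ Σ k, X k) → (O ⊕ Σ k, X k) → F := fun b e => p (.inr (b, e))
  let t := codeTransfer hG' (some S) p
  let Z : (Fin μ → F) →ₗ[F] ((Σ k, X k) → F) := LinearMap.funLeft F F Sum.inr ∘ₗ t
  have hZ : Function.Surjective Z := by
    rw [← LinearMap.range_eq_top]
    apply Submodule.eq_top_of_finrank_eq
    refine le_antisymm (Submodule.finrank_le _) ?_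
    rw [Module.finrank_fintype_fun_eq_card]
    refine hp.trans (finrank_range_eq_of_ker_eq _ _ ?_).le
    ext x
    simp only [LinearMap.mem_ker, funext_iff, LinearMap.comp_apply]
    constructor
    · intro hx q
      simpa [inProj, withSink, Z, t, LinearMap.funLeft_apply] using hx (.inr q)
    · rintro hx (a | q)
      · simp [inProj, withSink]
      · simpa [inProj, withSink, Z, t, LinearMap.funLeft_apply] using hx q
  -- `A` is the source precoding: after it the sink receives the requested symbols themselves.
  obtain ⟨A, hA, hZA⟩ := exists_injective_comp_eq Z
    (LinearMap.funLeft F F fun p : Σ k, X k => (p.2 : Fin μ)) hZ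
    (LinearMap.funLeft_surjective_of_injective _ _ _ hinj)
  let α : Fin μ → O → F := fun i e => ∑ j, p (.inl (j, .inl e)) * A (Pi.single i 1) j
  let β : I → O → F := fun b e => β' (.inl b) (.inl e)
  have hy : ∀ x, transfer hG S α β x = t (A x) ∘ Sum.inl := by
    intro x
    simp only [t, codeTransfer, transfer, LinearMap.comp_apply]
    rw [withSink_response_inl]
    refine congrArg (response hG β) (funext fun e => ?_)
    by_cases he : G.outNode e = S
    · simp only [srcMap, withSink, LinearMap.coe_mk, AddHom.coe_mk, Function.comp_apply,
        Sum.elim_inl, he, if_true, α]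
      simp only [linearMap_apply_eq_sum_single A x, Finset.sum_mul, Finset.mul_sum]
      rw [Finset.sum_comm]
      exact Finset.sum_congr rfl fun j _ => Finset.sum_congr rfl fun i _ => by ring
    · simp [srcMap, withSink, he]
  refine solvableOver_of_decodable hG α β ?_
  rintro d (⟨k, rfl⟩ | ⟨l, rfl⟩) i hi
  -- `T k` decodes with the coefficients with which it would feed its private edge. As `T k ≠ S`,
  -- the source injects nothing directly into that edge.
  · refine ⟨fun b => β' (.inl b) (.inr ⟨k, i, hi⟩), fun x => ?_⟩
    have h1 : Z (A x) ⟨k, i, hi⟩ = x i := congrFun (LinearMap.congr_fun hZA x) ⟨k, i, hi⟩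
    rw [← h1]
    change _ = t (A x) (.inr ⟨k, i, hi⟩)
    simp only [t, codeTransfer, transfer, LinearMap.comp_apply]
    rw [response_eq hG', withSink_edgeMap_inr, Pi.add_apply, withSink_outMap_inr]
    have h2 : (G.withSink fun p : Σ k, X k => T p.1).srcMap (some S)
        (fun i e => p (.inl (i, e))) (A x) (.inr ⟨k, i, hi⟩) = 0 := by
      simp [srcMap, withSink, hT]
    rw [h2, add_zero]
    refine Finset.sum_congr (by ext; simp) fun b _ => ?_
    change _ * transfer hG S α β x b = _
    rw [hy]
    rfl
  · let g := G.inProj {T' l} ∘ₗ transfer hG S α β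
    -- Rank `μ` at `T' l` means that nothing is lost before precoding, and `A` is injective.
    have hg : LinearMap.ker g = ⊥ := by
      rw [LinearMap.ker_eq_bot']
      intro x hx
      have hker : LinearMap.ker
          ((G.withSink fun p : Σ k, X k => T p.1).inProj {some (T' l)} ∘ₗ t) = ⊥ := by
        have h1 := LinearMap.finrank_range_add_finrank_ker
          ((G.withSink fun p : Σ k, X k => T p.1).inProj {some (T' l)} ∘ₗ t)
        have h2 := hp' l
        change μ ≤ finrank F (LinearMap.range
          ((G.withSink fun p : Σ k, X k => T p.1).inProj {some (T' l)} ∘ₗ t)) at h2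
        rw [Module.finrank_fin_fun] at h1
        exact Submodule.finrank_eq_zero.1 (by omega)
      apply hA
      rw [map_zero]
      refine LinearMap.ker_eq_bot'.1 hker _ ?_
      ext (a | q)
      · have h3 := congrFun hx a
        simp only [g, LinearMap.comp_apply, hy] at h3
        simpa [inProj, withSink] using h3
      · simp [inProj, withSink]
    obtain ⟨B, hB⟩ := g.exists_leftInverse_of_injective hg
    refine ⟨fun b => B (Pi.single b 1) i, fun x => ?_⟩
    have h1 : B (g x) = x := LinearMap.congr_fun hB x
    conv_rhs => rw [← h1, linearMap_apply_eq_sum_single]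
    rw [Finset.sum_filter]
    refine Finset.sum_congr rfl fun b _ => ?_
    by_cases hb : G.inNode b = T' l <;> simp [g, inProj, hb, mul_comm]

/-- Adjoin `n + 1` elements of the algebraic closure: the extension is finite-dimensional over a
finite field, hence finite. -/
theorem exists_finite_extension (F : Type u) [Field F] [Finite F] (n : ℕ) :
    ∃ (K : Type u) (_ : Field K) (_ : Fintype K) (_ : Algebra F K), n < Fintype.card K := by
  have : Infinite (AlgebraicClosure F) := IsAlgClosed.instInfinite
  obtain ⟨s, hs⟩ := Infinite.exists_subset_card_eq (AlgebraicClosure F) (n + 1)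
  let E := IntermediateField.adjoin F (s : Set (AlgebraicClosure F))
  have : FiniteDimensional F E := IntermediateField.finiteDimensional_adjoin fun x _ =>
    Algebra.IsIntegral.isIntegral x
  have : Finite E := Module.finite_of_finite F
  let _ := Fintype.ofFinite E
  refine ⟨E, inferInstance, inferInstance, inferInstance, ?_⟩
  have := Fintype.card_le_of_injective (fun x : s => (⟨x, IntermediateField.subset_adjoin F _ x.2⟩ : E))
    fun x y h => Subtype.ext (Subtype.mk.inj h)
  rw [Fintype.card_coe] at this
  omega

end TwoLevel

end ADTNetwork

open ADTNetwork in
theorem mainTheorem7 {V I O : Type*} [Fintype V] [DecidableEq V] [Fintype I] [Fintype O]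
    (F : Type u) [Field F] [Fintype F] (G : ADTNetwork V I O) (hG : G.Acyclic) (S : V)
    (μ K L : ℕ) (T : Fin K → V) (T' : Fin L → V) (hT : ∀ k, T k ≠ S) (hT' : ∀ l, T' l ≠ S)
    (X : Fin K → Finset (Fin μ)) (hX : ∀ k₁ k₂, k₁ ≠ k₂ → Disjoint (X k₁) (X k₂)) :
    (G.Solvable F S (twoLevelConnections T X T') ↔ TwoLevelCutConditions G F S T X T') ∧
    (K + L < Fintype.card F →
      (G.SolvableOver F S (twoLevelConnections T X T') ↔
        TwoLevelCutConditions G F S T X T')) := by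
  -- Cut ranks do not change under extension, so the conditions over `F` can be used over any
  -- extension in either direction.
  have hext : ∀ (F' : Type u) [Field F'] [Algebra F F'],
      TwoLevelCutConditions G F' S T X T' ↔ TwoLevelCutConditions G F S T X T' := by
    intro F' _ _
    simp only [TwoLevelCutConditions, mincut_eq F F']
  refine ⟨⟨?_, fun h => ?_⟩, fun hcard =>
    ⟨fun h => h.twoLevelCutConditions hG hT hT' hX, fun h => solvableOver_of_twoLevelCutConditions hG hT hT' hX hcard h⟩⟩
  · rintro ⟨F', _, _, _, h⟩
    exact (hext F').1 (h.twoLevelCutConditions hG hT hT' hX)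
  · obtain ⟨F', _, _, _, hF'⟩ := exists_finite_extension F (K + L)
    exact ⟨F', inferInstance, inferInstance, inferInstance,
      solvableOver_of_twoLevelCutConditions hG hT hT' hX hF' ((hext F').2 h)⟩
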